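/- **Definitions.** For a topological space $X$, a function $f:X\to\mathbb R$ and $a\in\mathbb R$ put $X_a=f^{-1}(-\infty,a]$, and let $H_k$ be $k$-th singular homology with coefficients in a fixed commutative ring $R\neq 0$. A *symmetric homological critical value* of $f$ is a real number $a$ for which there is a $k$ such that for all sufficiently small $\varepsilon>0$ the map $H_k(X_{a-\varepsilon})\to H_k(X_{a+\varepsilon})$ induced by inclusion is not an isomorphism. The *critical value lemma* for $f$ asserts: whenever $x\le y$ and $f$ has no symmetric homological critical values in $[x,y]$, the inclusion $X_x\hookrightarrow X_y$ induces isomorphisms on all homology groups. Let $\vartheta(t)=e^{-1/t^2}$ for $t>0$ and $\vartheta(t)=0$ for $t\le 0$; let $f(x,y)=e^{-1/x^2}\left(y-\sin\frac{\pi}{x}\right)^2$ for $x\ne 0$ and $f(0,y)=0$; and let $$h(x,y)=f(x,y)-\vartheta\left(\tfrac14-(x-1)^2\right)+x^2\vartheta(x^2-4)+y^2\vartheta(y^2-4),\qquad (x,y)\in\mathbb R^2 .$$ Let $S^2\subset\mathbb R^3$ be the unit sphere, $N=(0,0,1)$, $p:S^2\setminus\{N\}\to\mathbb R^2$, $p(x,y,z)=\left(\frac{x}{1-z},\frac{y}{1-z}\right)$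 the stereographic projection, and $K=(h\circ p)^{-1}(-\infty,1]$. A *cutoff* is a smooth function $\eta:S^2\to[0,1]$ that is $0$ in a neighbourhood of $N$ and $1$ on $K$. For a cutoff $\eta$ define $H:S^2\to\mathbb R$ by $H=(h\circ p)\,\eta+(1-\eta)$ on $S^2\setminus\{N\}$ and $H(N)=1$; let $i:S^2\to\mathbb R^4$, $i(x,y,z)=(x,y,z,H(x,y,z))$, and let $F:i(S^2)\to\mathbb R$, $F(x,y,z,w)=w$, be the height function. **Theorem.** Cutoffs exist, and for every cutoff $\eta$: 1. $H$ is smooth and $i$ is a smooth embedding, so $i(S^2)$ is a compact smooth surface embedded in $\mathbb R^4$; 2. the sublevel set $F^{-1}(-\infty,a]$ is contractible for every $a\in[-e^{-16},0)$ and every $a\in(0,1)$; 3. the sublevel set $F^{-1}(-\infty,0]$ is connected and has exactly three path components, each of which is contractible; 4. for every commutative coefficient ring $R\ne0$, $F$ has no symmetric homological critical values in $(-e^{-16},1)$; nevertheless, for every $x\in(-e^{-16},0)$ the inclusion $F^{-1}(-\infty,x]\hookrightarrow F^{-1}(-\infty,0]$ does not induce an isomorphism on $H_0$. Hence the critical value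 lemma (in terms of symmetric homological critical values) fails for the smooth height function $F$ on the compact manifold $i(S^2)$. -/

import Mathlib

open Set Filter Topology CategoryTheory AlgebraicTopology
open scoped Manifold ContDiff

noncomputable section

/-! ### Sublevel sets, singular homology and homological critical values -/

/-- The closed sublevel set `f ⁻¹' (-∞, a]`. -/
def sublevel {X : Type} (f : X → ℝ) (a : ℝ) : Set X := f ⁻¹' Iic a

theorem sublevel_mono {X : Type} (f : X → ℝ) {a b : ℝ} (hab : a ≤ b) :
    sublevel f a ⊆ sublevel f b :=
  fun _ hx => le_trans hx hab

/-- The inclusion of sublevel sets `X_a ↪ X_b` (with subspace topologies) for `a ≤ b`. -/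
def sublevelInclusion {X : Type} [TopologicalSpace X] (f : X → ℝ) {a b : ℝ} (hab : a ≤ b) :
    TopCat.of (sublevel f a) ⟶ TopCat.of (sublevel f b) :=
  TopCat.ofHom ⟨Set.inclusion (sublevel_mono f hab), continuous_inclusion (sublevel_mono f hab)⟩

/-- The map induced on the `k`-th singular homology, with coefficients in `R`, by the inclusion
`X_a ↪ X_b`. -/
def sublevelHomologyMap (R : Type) [CommRing R] (k : ℕ) {X : Type} [TopologicalSpace X]
    (f : X → ℝ) {a b : ℝ} (hab : a ≤ b) :
    ((singularHomologyFunctor (ModuleCat.{0} R) k).obj (ModuleCat.of R R)).obj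
        (TopCat.of (sublevel f a)) ⟶
      ((singularHomologyFunctor (ModuleCat.{0} R) k).obj (ModuleCat.of R R)).obj
        (TopCat.of (sublevel f b)) :=
  ((singularHomologyFunctor (ModuleCat.{0} R) k).obj (ModuleCat.of R R)).map
    (sublevelInclusion f hab)

/-- `a` is a symmetric homological critical value of `f` (with coefficients in `R`): there is a
`k` such that, for all sufficiently small `ε > 0`, the map
`H_k(f ⁻¹' (-∞, a - ε]) → H_k(f ⁻¹' (-∞, a + ε])` induced by inclusion is not an isomorphism. -/
def IsSymmetricHomologicalCriticalValue (R : Type) [CommRing R] {X : Type} [TopologicalSpace X]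
    (f : X → ℝ) (a : ℝ) : Prop :=
  ∃ k : ℕ, ∃ δ > 0, ∀ (ε : ℝ) (hε : 0 < ε), ε < δ →
    ¬ IsIso (sublevelHomologyMap R k f (show a - ε ≤ a + ε by linarith))

/-- The assertion of the critical value lemma, in terms of symmetric homological critical values,
for one function `f`: whenever `[x, y]` contains none of them, the inclusion `X_x ↪ X_y` induces
isomorphisms on all homology groups. -/
def SatisfiesCriticalValueLemma (R : Type) [CommRing R] {X : Type} [TopologicalSpace X]
    (f : X → ℝ) : Prop :=
  ∀ (x y : ℝ) (hxy : x ≤ y), (∀ c ∈ Icc x y, ¬ IsSymmetricHomologicalCriticalValue R f c) →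
    ∀ k : ℕ, IsIso (sublevelHomologyMap R k f hxy)

/-! ### The functions on the plane -/

/-- `ϑ(x) = exp (-1/x²)` for `x > 0`, and `ϑ(x) = 0` for `x ≤ 0`. -/
def bumpTheta (x : ℝ) : ℝ :=
  if 0 < x then Real.exp (-1 / x ^ 2) else 0

/-- `f(x, y) = exp (-1/x²) (y - sin (π/x))²` for `x ≠ 0`, and `f(0, y) = 0`. -/
def planeF (x y : ℝ) : ℝ :=
  if x = 0 then 0 else Real.exp (-1 / x ^ 2) * (y - Real.sin (Real.pi / x)) ^ 2

/-- `h(x, y) = f(x, y) - ϑ(1/4 - (x-1)²) + x² ϑ(x² - 4) + y² ϑ(y² - 4)`. -/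
def planeH (x y : ℝ) : ℝ :=
  planeF x y - bumpTheta (1 / 4 - (x - 1) ^ 2) + x ^ 2 * bumpTheta (x ^ 2 - 4)
    + y ^ 2 * bumpTheta (y ^ 2 - 4)

/-! ### The function on the sphere and the surface in `ℝ⁴` -/

/-- The unit sphere `S²` in `ℝ³`. -/
abbrev S2 : Type := Metric.sphere (0 : EuclideanSpace ℝ (Fin 3)) 1

/-- The north pole `(0, 0, 1)`. -/
def northPole : S2 := ⟨!₂[0, 0, 1], by simp [EuclideanSpace.norm_eq, Fin.sum_univ_three]⟩

/-- `h ∘ p`, where `p (x, y, z) = (x / (1 - z), y / (1 - z))` is the stereographic projection from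
the north pole; the value at the north pole itself is irrelevant. -/
def sphereH (w : S2) : ℝ :=
  planeH (w.1 0 / (1 - w.1 2)) (w.1 1 / (1 - w.1 2))

/-- The compact set `K = (h ∘ p)⁻¹ (-∞, 1]`, a subset of the sphere without the north pole. -/
def compactK : Set S2 := {w | w ≠ northPole ∧ sphereH w ≤ 1}

/-- A smooth cutoff function `η : S² → [0, 1]` that equals `0` in a neighbourhood of the north pole
and `1` on `K`. -/
structure IsCutoff (η : S2 → ℝ) : Prop where
  smooth : ContMDiff (𝓡 2) 𝓘(ℝ, ℝ) ∞ η
  mem_Icc : ∀ w, η w ∈ Icc (0 : ℝ) 1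
  eventually_eq_zero : ∀ᶠ w in 𝓝 northPole, η w = 0
  eq_one : ∀ w ∈ compactK, η w = 1

open Classical in
/-- `H = (h ∘ p) η + (1 - η)` away from the north pole, and `H = 1` at the north pole. -/
def bigH (η : S2 → ℝ) (w : S2) : ℝ :=
  if w = northPole then 1 else sphereH w * η w + (1 - η w)

/-- `i (x, y, z) = (x, y, z, H (x, y, z))`. -/
def graphEmb (η : S2 → ℝ) (w : S2) : EuclideanSpace ℝ (Fin 4) :=
  !₂[w.1 0, w.1 1, w.1 2, bigH η w]

/-- The surface `i (S²)` in `ℝ⁴`, with the subspace topology. -/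
abbrev surface (η : S2 → ℝ) : Type := Set.range (graphEmb η)

/-- The height function `F (x, y, z, w) = w` on the surface `i (S²)`. -/
def height (η : S2 → ℝ) (q : surface η) : ℝ := q.1 3

end

/-! ### Smoothness of flat functions -/

/-! The level `0` is invisible to symmetric critical values because those compare only the levels `a
- ε` and `a + ε`. Every sublevel set at a level in `[-e⁻¹⁶, 1)` other than `0` is contractible, and
for each `a` arbitrarily small `ε` avoid `a ± ε = 0`, so the comparison map is an isomorphism. The
level `0` itself carries a topologist's sine curve with three path components, so `H₀` jumps from
rank one to rank three on arrival at `0`.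

In the plane, `h(x, y) = planeF x y + fibreMin x + confine y`. On each vertical line `h` decreases
towards `y = sin (π / x)`, where its value is `fibreMin x`, and `fibreMin` decreases towards `x =
1`. So a sublevel set lies over an interval with intervals as fibres, and it contracts as soon as it
has a continuous section (`contractibleSpace_of_section`). Below `0` it stays in `x > 1/2`, where
`sin (π / x)` is continuous. Above `0` there is room to damp the sine near `x = 0`. At `0` there is
no room: for `x ≤ 1/2`, `x ≠ 0`, it lies on the sine curve, and no path joins that curve to the
`y`-axis (`sign_fst_eq_of_continuous`).

Stereographic projection identifies the sublevel sets of the height function below level `1` with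
the planar ones (`sublevelHomeo`), whatever the cutoff. Smoothness of `h` comes from a family of
flat functions closed under differentiation, and the immersion property from charts of `ℝ⁴` that
straighten a graph over the sphere. -/

open Polynomial in
/-- `w(x) exp(-1/x²) (P(1/x) sin(c/x) + Q(1/x) cos(c/x))`. -/
noncomputable def flatTrig (w : ℝ → ℝ) (c : ℝ) (P Q : ℝ[X]) (x : ℝ) : ℝ :=
  w x * (Real.exp (-(x⁻¹) ^ 2) *
    (P.eval x⁻¹ * Real.sin (c * x⁻¹) + Q.eval x⁻¹ * Real.cos (c * x⁻¹)))

/-- Weights that are bounded by `1`, vanish at `0` and are locally constant elsewhere. -/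
structure IsStepWeight (w : ℝ → ℝ) : Prop where
  zero : w 0 = 0
  abs_le : ∀ x, |w x| ≤ 1
  eventually_eq : ∀ x, x ≠ 0 → ∀ᶠ y in 𝓝 x, w y = w x

open Polynomial in
theorem tendsto_polynomial_mul_exp_neg_sq (P : ℝ[X]) :
    Tendsto (fun u : ℝ => P.eval u * Real.exp (-u ^ 2)) (cocompact ℝ) (𝓝 0) := by
  induction P using Polynomial.induction_on' with
  | add p q hp hq => simpa [add_mul] using hp.add hq
  | monomial n a =>
    have h := tendsto_rpow_abs_mul_exp_neg_mul_sq_cocompact one_pos (n : ℝ)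
    rw [tendsto_zero_iff_abs_tendsto_zero]
    have h2 := h.const_mul |a|
    rw [mul_zero] at h2
    refine h2.congr fun u => ?_
    simp [abs_mul, abs_pow, mul_assoc, Real.rpow_natCast]

-- With `u = 1 / x`, the difference quotient at `0` is at most a polynomial in `u` times `exp
-- (-u²)`, which vanishes as `|u| → ∞`.
open Polynomial in
theorem flatTrig_hasDerivAt_zero {w : ℝ → ℝ} (hw : IsStepWeight w) (c : ℝ) (P Q : ℝ[X]) :
    HasDerivAt (flatTrig w c P Q) 0 0 := by
  rw [hasDerivAt_iff_tendsto_slope]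
  have hinv : Tendsto (fun x : ℝ => x⁻¹) (𝓝[≠] 0) (cocompact ℝ) := by
    rw [← Metric.cobounded_eq_cocompact]
    exact tendsto_inv₀_nhdsNE_zero
  have h1 := ((tendsto_polynomial_mul_exp_neg_sq (X * P)).comp hinv).abs.add
    ((tendsto_polynomial_mul_exp_neg_sq (X * Q)).comp hinv).abs
  simp only [abs_zero, add_zero] at h1
  refine squeeze_zero_norm (fun x => ?_) h1
  have e : slope (flatTrig w c P Q) 0 x = x⁻¹ * flatTrig w c P Q x := by
    simp [slope_def_field, flatTrig, hw.zero, div_eq_inv_mul]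
  rw [e]
  simp only [flatTrig, Function.comp, eval_mul, eval_X, Real.norm_eq_abs, abs_mul, Real.abs_exp]
  have hs := Real.abs_sin_le_one (c * x⁻¹)
  have hc := Real.abs_cos_le_one (c * x⁻¹)
  have hE := (Real.exp_pos (-(x⁻¹) ^ 2)).le
  have hwx := hw.abs_le x
  have h2 : |P.eval x⁻¹ * Real.sin (c * x⁻¹) + Q.eval x⁻¹ * Real.cos (c * x⁻¹)| ≤
      |P.eval x⁻¹| + |Q.eval x⁻¹| := by
    refine (abs_add_le _ _).trans ?_
    rw [abs_mul, abs_mul]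
    exact add_le_add (mul_le_of_le_one_right (abs_nonneg _) hs)
      (mul_le_of_le_one_right (abs_nonneg _) hc)
  calc |x⁻¹| * (|w x| * (Real.exp (-(x⁻¹) ^ 2) * _))
      ≤ |x⁻¹| * (1 * (Real.exp (-(x⁻¹) ^ 2) * (|P.eval x⁻¹| + |Q.eval x⁻¹|))) := by gcongr
    _ = _ := by ring

-- The family is closed under differentiation: the derivative has the same weight and frequency,
-- with new polynomials. Smoothness then follows by induction on the order.
open Polynomial in
theorem flatTrig_hasDerivAt {w : ℝ → ℝ} (hw : IsStepWeight w) (c : ℝ) (P Q : ℝ[X]) (x : ℝ) :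
    HasDerivAt (flatTrig w c P Q)
      (flatTrig w c (2 * X ^ 3 * P - X ^ 2 * (derivative P - C c * Q))
        (2 * X ^ 3 * Q - X ^ 2 * (derivative Q + C c * P)) x) x := by
  rcases eq_or_ne x 0 with rfl | hx
  · have e : ∀ P Q, flatTrig w c P Q 0 = 0 := fun P Q => by simp [flatTrig, hw.zero]
    rw [e]
    exact flatTrig_hasDerivAt_zero hw c P Q
  · have hi := hasDerivAt_inv hx
    have hexp := ((hi.pow 2).fun_neg).exp
    have hP := (P.hasDerivAt x⁻¹).comp x hi
    have hQ := (Q.hasDerivAt x⁻¹).comp x hi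
    have hs := (hi.const_mul c).sin
    have hc := (hi.const_mul c).cos
    have h := (hexp.mul ((hP.mul hs).add (hQ.mul hc))).const_mul (w x)
    refine (h.congr_of_eventuallyEq ?_).congr_deriv ?_
    · filter_upwards [hw.eventually_eq x hx] with y hy
      simp [flatTrig, hy]
    · simp [flatTrig]
      left
      ring

open Polynomial in
theorem flatTrig_contDiff {w : ℝ → ℝ} (hw : IsStepWeight w) (c : ℝ) (P Q : ℝ[X]) :
    ContDiff ℝ ∞ (flatTrig w c P Q) := by
  rw [contDiff_infty]
  intro n
  induction n generalizing P Q with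
  | zero =>
    refine contDiff_zero.2 (continuous_iff_continuousAt.2 fun x => ?_)
    exact (flatTrig_hasDerivAt hw c P Q x).continuousAt
  | succ n ih =>
    push_cast
    rw [contDiff_succ_iff_deriv]
    refine ⟨fun x => (flatTrig_hasDerivAt hw c P Q x).differentiableAt, by simp, ?_⟩
    rw [show deriv (flatTrig w c P Q) = _ from funext fun x => (flatTrig_hasDerivAt hw c P Q x).deriv]
    exact ih _ _

theorem isStepWeight_pos : IsStepWeight fun x => if 0 < x then 1 else 0 where
  zero := by simp
  abs_le x := by split_ifs <;> simp
  eventually_eq x hx := by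
    rcases hx.lt_or_gt with h | h
    · filter_upwards [gt_mem_nhds h] with y hy
      simp [hy.not_gt, h.not_gt]
    · filter_upwards [lt_mem_nhds h] with y hy
      simp [hy, h]

theorem isStepWeight_ne : IsStepWeight fun x => if x = 0 then 0 else 1 where
  zero := by simp
  abs_le x := by split_ifs <;> simp
  eventually_eq x hx := by
    filter_upwards [isOpen_ne.mem_nhds hx] with y hy
    simp only [if_neg hx, if_neg hy]

theorem bumpTheta_contDiff : ContDiff ℝ ∞ bumpTheta := by
  convert flatTrig_contDiff isStepWeight_pos 0 0 1 using 1
  ext x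
  simp [bumpTheta, flatTrig, neg_div]

theorem planeF_contDiff : ContDiff ℝ ∞ fun p : ℝ × ℝ => planeF p.1 p.2 := by
  have h := fun c P Q => (flatTrig_contDiff isStepWeight_ne c P Q).comp
    (contDiff_fst (𝕜 := ℝ) (E := ℝ) (F := ℝ))
  have hy := contDiff_snd (𝕜 := ℝ) (E := ℝ) (F := ℝ) (n := ∞)
  -- The square is expanded and `sin²(π/x)` is written as `(1 - cos (2π/x)) / 2`, so that every
  -- function of `x` is linear in a sine or cosine and belongs to the flat family.
  have key := ((((hy.pow 2).mul (h 0 0 1)).sub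
    ((contDiff_const (c := (2 : ℝ))).mul (hy.mul (h Real.pi 1 0)))).add
    ((contDiff_const (c := (1 / 2 : ℝ))).mul (h 0 0 1))).sub
    ((contDiff_const (c := (1 / 2 : ℝ))).mul (h (2 * Real.pi) 0 1))
  refine (congrArg (ContDiff ℝ ∞) (funext fun p => ?_)).mpr key
  simp only [planeF, flatTrig, Function.comp]
  split_ifs with hp
  · simp
  · simp only [div_eq_mul_inv, mul_assoc (2 : ℝ), Real.cos_two_mul']
    have := Real.sin_sq_add_cos_sq (Real.pi * p.1⁻¹)
    simp only [Polynomial.eval_zero, Polynomial.eval_one, zero_mul, Real.cos_zero, Real.sin_zero]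
    rw [show (-1 * (p.1 ^ 2)⁻¹) = -(p.1⁻¹) ^ 2 by rw [inv_pow]; ring, Real.cos_sq']
    ring

theorem planeH_contDiff : ContDiff ℝ ∞ fun p : ℝ × ℝ => planeH p.1 p.2 := by
  have hx := contDiff_fst (𝕜 := ℝ) (E := ℝ) (F := ℝ) (n := ∞)
  have hy := contDiff_snd (𝕜 := ℝ) (E := ℝ) (F := ℝ) (n := ∞)
  have h1 := bumpTheta_contDiff.comp
    ((contDiff_const (c := (1 / 4 : ℝ))).sub ((hx.sub (contDiff_const (c := (1 : ℝ)))).pow 2))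
  have h2 := bumpTheta_contDiff.comp ((hx.pow 2).sub (contDiff_const (c := (4 : ℝ))))
  have h3 := bumpTheta_contDiff.comp ((hy.pow 2).sub (contDiff_const (c := (4 : ℝ))))
  exact ((planeF_contDiff.sub h1).add ((hx.pow 2).mul h2)).add ((hy.pow 2).mul h3)

/-! ### Elementary properties of the functions on the plane -/

theorem bumpTheta_of_nonpos {t : ℝ} (ht : t ≤ 0) : bumpTheta t = 0 := if_neg ht.not_gt

theorem bumpTheta_of_pos {t : ℝ} (ht : 0 < t) : bumpTheta t = Real.exp (-1 / t ^ 2) := if_pos ht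

theorem bumpTheta_nonneg (t : ℝ) : 0 ≤ bumpTheta t := by
  unfold bumpTheta
  split_ifs <;> positivity

theorem bumpTheta_mono : Monotone bumpTheta := by
  intro s t hst
  rcases le_or_gt s 0 with hs | hs
  · rw [bumpTheta_of_nonpos hs]
    exact bumpTheta_nonneg t
  · rw [bumpTheta_of_pos hs, bumpTheta_of_pos (hs.trans_le hst), neg_div, neg_div]
    gcongr

/-- The confining term `y² ϑ(y² - 4)`. -/
noncomputable def confine (y : ℝ) : ℝ := y ^ 2 * bumpTheta (y ^ 2 - 4)

theorem confine_nonneg (y : ℝ) : 0 ≤ confine y := mul_nonneg (sq_nonneg _) (bumpTheta_nonneg _)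

theorem confine_eq_zero {y : ℝ} (hy : |y| ≤ 2) : confine y = 0 := by
  have : y ^ 2 ≤ 2 ^ 2 := sq_le_sq' (abs_le.1 hy).1 (abs_le.1 hy).2
  rw [confine, bumpTheta_of_nonpos (by linarith), mul_zero]

theorem confine_le {y z : ℝ} (h : |z| ≤ max 2 |y|) : confine z ≤ confine y := by
  rcases le_max_iff.1 h with h | h
  · rw [confine_eq_zero h]
    exact confine_nonneg y
  · have h2 : z ^ 2 ≤ y ^ 2 := sq_le_sq.2 h
    exact mul_le_mul h2 (bumpTheta_mono (by linarith)) (bumpTheta_nonneg _) (sq_nonneg _)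

theorem confine_le_of_mem_uIcc {c y z : ℝ} (hc : |c| ≤ 2) (hz : z ∈ uIcc c y) :
    confine z ≤ confine y := by
  refine confine_le ?_
  rw [mem_uIcc] at hz
  rw [le_max_iff]
  rcases abs_cases z with h | h <;> rcases abs_cases y with h' | h' <;>
    rcases abs_cases c with h'' | h'' <;> grind

/-- The minimum of `h` over the vertical line through `x`. -/
noncomputable def fibreMin (x : ℝ) : ℝ := -bumpTheta (1 / 4 - (x - 1) ^ 2) + confine x

theorem planeH_eq (x y : ℝ) : planeH x y = planeF x y + fibreMin x + confine y := by
  simp only [planeH, fibreMin, confine]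
  ring

theorem planeF_nonneg (x y : ℝ) : 0 ≤ planeF x y := by
  unfold planeF
  split_ifs <;> positivity

theorem planeF_sin (x : ℝ) : planeF x (Real.sin (Real.pi / x)) = 0 := by
  simp [planeF]

/-- This includes `x = 0`: there `π / 0 = 0`, so the marked point is the origin, and `h` is indeed
minimal there along the `y`-axis. -/
theorem planeH_sin (x : ℝ) : planeH x (Real.sin (Real.pi / x)) = fibreMin x := by
  rw [planeH_eq, planeF_sin, confine_eq_zero ((Real.abs_sin_le_one _).trans one_le_two)]
  ring

theorem fibreMin_le_planeH (x y : ℝ) : fibreMin x ≤ planeH x y := by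
  rw [planeH_eq]
  linarith [planeF_nonneg x y, confine_nonneg y]

theorem planeF_le_of_mem_uIcc {x y z : ℝ} (hz : z ∈ uIcc (Real.sin (Real.pi / x)) y) :
    planeF x z ≤ planeF x y := by
  unfold planeF
  split_ifs
  · exact le_rfl
  · gcongr ?_ * ?_
    exact sq_le_sq.2 (abs_sub_left_of_mem_uIcc hz)

theorem planeH_le_of_mem_uIcc {x y z : ℝ} (hz : z ∈ uIcc (Real.sin (Real.pi / x)) y) :
    planeH x z ≤ planeH x y := by
  rw [planeH_eq, planeH_eq]
  gcongr
  · exact planeF_le_of_mem_uIcc hz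
  · exact confine_le_of_mem_uIcc ((Real.abs_sin_le_one _).trans one_le_two) hz

theorem fibreMin_le_of_mem_uIcc {x z : ℝ} (hz : z ∈ uIcc 1 x) : fibreMin z ≤ fibreMin x := by
  unfold fibreMin
  gcongr
  · apply bumpTheta_mono
    have := sq_le_sq.2 (abs_sub_left_of_mem_uIcc hz)
    linarith
  · exact confine_le_of_mem_uIcc (by norm_num) hz

/-- Sublevel sets of a function that decreases towards a point are intervals. -/
theorem le_of_mem_uIcc_of_star {φ : ℝ → ℝ} {c a : ℝ}
    (h : ∀ x, ∀ z ∈ uIcc c x, φ z ≤ φ x) {x y z : ℝ} (hx : φ x ≤ a) (hy : φ y ≤ a)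
    (hz : z ∈ uIcc x y) : φ z ≤ a := by
  rcases uIcc_subset_uIcc_union_uIcc (b := c) hz with hz | hz
  · exact (h x z (uIcc_comm x c ▸ hz)).trans hx
  · exact (h y z hz).trans hy

theorem fibreMin_ordConnected (a : ℝ) : OrdConnected {x | fibreMin x ≤ a} :=
  ordConnected_iff_uIcc_subset.2 fun _ hx _ hy _ hz =>
    le_of_mem_uIcc_of_star (fun _ _ => fibreMin_le_of_mem_uIcc) hx hy hz

theorem fibreMin_one : fibreMin 1 = -Real.exp (-16) := by
  rw [fibreMin, confine_eq_zero (by norm_num), bumpTheta_of_pos (by norm_num)]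
  norm_num

theorem fibreMin_nonpos {x : ℝ} (hx : |x| ≤ 2) : fibreMin x ≤ 0 := by
  rw [fibreMin, confine_eq_zero hx]
  linarith [bumpTheta_nonneg (1 / 4 - (x - 1) ^ 2)]

theorem half_lt_of_fibreMin_neg {x : ℝ} (hx : fibreMin x < 0) : 1 / 2 < x := by
  by_contra! h
  have : bumpTheta (1 / 4 - (x - 1) ^ 2) = 0 := bumpTheta_of_nonpos (by nlinarith)
  rw [fibreMin, this] at hx
  linarith [confine_nonneg x]

theorem fibreMin_nonneg {x : ℝ} (hx : x ≤ 1 / 2) : 0 ≤ fibreMin x := by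
  by_contra! h
  exact hx.not_gt (half_lt_of_fibreMin_neg h)

/-! ### Contractibility of planar sublevel sets -/

/-- A planar set that contracts fibrewise onto a section over an interval is contractible. -/
theorem contractibleSpace_of_section {S : Set (ℝ × ℝ)} {B : Set ℝ} (hB : OrdConnected B)
    (hne : B.Nonempty) {σ : ℝ → ℝ} (hσ : ContinuousOn σ B) (hS : ∀ p ∈ S, p.1 ∈ B)
    (hσS : ∀ x ∈ B, (x, σ x) ∈ S) (hfib : ∀ p ∈ S, ∀ z ∈ uIcc p.2 (σ p.1), (p.1, z) ∈ S) :
    ContractibleSpace S := by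
  have := hB.convex.contractibleSpace hne
  let f : C(S, B) := ⟨fun p => ⟨p.1.1, hS p p.2⟩, by fun_prop⟩
  have hσ' : Continuous fun x : B => σ x := hσ.domRestrict
  let g : C(B, S) := ⟨fun x => ⟨(x, σ x), hσS x x.2⟩,
    (continuous_subtype_val.prodMk hσ').subtype_mk _⟩
  have hf : Continuous fun p : S => σ p.1.1 := hσ'.comp f.continuous
  let H : (g.comp f).Homotopy (ContinuousMap.id S) :=
    { toFun := fun q => ⟨(q.2.1.1, AffineMap.lineMap (σ q.2.1.1) q.2.1.2 (q.1 : ℝ)),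
        hfib _ q.2.2 _ (by
          rw [uIcc_comm, ← segment_eq_uIcc, segment_eq_image_lineMap]
          exact ⟨q.1, q.1.2, rfl⟩)⟩
      continuous_toFun := by
        have : Continuous fun q : unitInterval × S => σ q.2.1.1 := hf.comp continuous_snd
        refine Continuous.subtype_mk (.prodMk (by fun_prop) ?_) _
        simp only [AffineMap.lineMap_apply, vsub_eq_sub, smul_eq_mul, vadd_eq_add]
        have h2 : Continuous fun q : unitInterval × S => q.2.1.2 := by fun_prop
        exact ((continuous_subtype_val.comp continuous_fst).mul (h2.sub this)).add this
      map_zero_left := fun p => by simp [f, g]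
      map_one_left := fun p => by simp }
  let e : ContinuousMap.HomotopyEquiv S B :=
    { toFun := f
      invFun := g
      left_inv := ⟨H⟩
      right_inv := by
        have : f.comp g = ContinuousMap.id B := by ext x; rfl
        rw [this] }
  exact e.contractibleSpace

/-- The section is the curve of fibrewise minima. Its continuity is the only obstruction, hence the
restriction to a base `C` on which it holds. -/
theorem contractibleSpace_planeH_over {a : ℝ} {C : Set ℝ} (hC : OrdConnected C)
    (hσ : ContinuousOn (fun x => Real.sin (Real.pi / x)) C) {x₀ : ℝ} (hx₀ : x₀ ∈ C)
    (ha : fibreMin x₀ ≤ a) : ContractibleSpace {p : ℝ × ℝ | planeH p.1 p.2 ≤ a ∧ p.1 ∈ C} := by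
  refine contractibleSpace_of_section (B := {x | fibreMin x ≤ a} ∩ C)
    ((fibreMin_ordConnected a).inter hC) ⟨x₀, ha, hx₀⟩ (hσ.mono inter_subset_right)
    (fun p hp => ⟨(fibreMin_le_planeH _ _).trans hp.1, hp.2⟩)
    (fun x hx => ⟨(planeH_sin x).trans_le hx.1, hx.2⟩) fun p hp z hz => ⟨?_, hp.2⟩
  exact (planeH_le_of_mem_uIcc (by rwa [uIcc_comm])).trans hp.1

theorem continuousOn_sin_pi_div {C : Set ℝ} (hC : ∀ x ∈ C, x ≠ 0) :
    ContinuousOn (fun x => Real.sin (Real.pi / x)) C :=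
  Real.continuous_sin.comp_continuousOn (continuousOn_const.div continuousOn_id hC)

theorem contractibleSpace_planeH_of_neg {a : ℝ} (ha : a ∈ Ico (-Real.exp (-16)) 0) :
    ContractibleSpace {p : ℝ × ℝ | planeH p.1 p.2 ≤ a} := by
  have h := contractibleSpace_planeH_over (a := a) (C := Ioi 0) ordConnected_Ioi
    (continuousOn_sin_pi_div fun x hx => ne_of_gt hx) (x₀ := 1) (by simp) (fibreMin_one.trans_le ha.1)
  have e : {p : ℝ × ℝ | planeH p.1 p.2 ≤ a} = {p | planeH p.1 p.2 ≤ a ∧ p.1 ∈ Ioi 0} := by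
    ext p
    refine ⟨fun hp => ⟨hp, ?_⟩, And.left⟩
    have := half_lt_of_fibreMin_neg (((fibreMin_le_planeH _ _).trans hp).trans_lt ha.2)
    exact mem_Ioi.2 (by linarith)
  rw [e]
  exact h

theorem continuous_damped_sin (δ : ℝ) :
    Continuous fun x : ℝ => min (|x| / δ) 1 * Real.sin (Real.pi / x) := by
  rw [continuous_iff_continuousAt]
  intro x
  have hm : Continuous fun x : ℝ => min (|x| / δ) 1 := by fun_prop
  rcases eq_or_ne x 0 with rfl | hx
  · rw [ContinuousAt]
    have h0 : Tendsto (fun x : ℝ => min (|x| / δ) 1) (𝓝 0) (𝓝 0) := by simpa using hm.tendsto 0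
    simpa using h0.zero_mul_isBoundedUnder_le
      (isBoundedUnder_of ⟨1, fun x => Real.abs_sin_le_one (Real.pi / x)⟩)
  · exact hm.continuousAt.mul ((continuousOn_sin_pi_div (C := {x | x ≠ 0}) fun _ h => h).continuousAt
      (isOpen_ne.mem_nhds hx))

/-- The section is the damped sine. Near `x = 0` it differs from `sin (π / x)` by at most `1`, so
`planeF` there costs at most `exp (-1 / x²) ≤ a`; away from `0` it is the curve of minima itself.
Fibres are intervals, so segments to the section stay inside. -/
theorem contractibleSpace_planeH_of_pos {a : ℝ} (ha : 0 < a) :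
    ContractibleSpace {p : ℝ × ℝ | planeH p.1 p.2 ≤ a} := by
  obtain ⟨δ, hδ, hδ'⟩ : ∃ δ > 0, ∀ x, |x| < δ → bumpTheta |x| ≤ a := by
    have hc : Continuous fun x : ℝ => bumpTheta |x| :=
      bumpTheta_contDiff.continuous.comp continuous_abs
    have := (hc.tendsto 0).eventually_le_const (u := a) (by simpa [bumpTheta] using ha)
    obtain ⟨δ, hδ, h⟩ := Metric.eventually_nhds_iff.1 this
    exact ⟨δ, hδ, fun x hx => h (by simpa using hx)⟩
  -- The bound `2` ensures `fibreMin x ≤ 0` on the damped range.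
  set δ' := min δ 2 with hδ2
  have hδ0 : 0 < δ' := lt_min hδ two_pos
  have key : ∀ x, fibreMin x ≤ a →
      planeH x (min (|x| / δ') 1 * Real.sin (Real.pi / x)) ≤ a := by
    intro x hx
    rcases le_or_gt δ' |x| with h | h
    · rwa [min_eq_right ((one_le_div hδ0).2 h), one_mul, planeH_sin]
    · set m := min (|x| / δ') 1 with hm
      have hm0 : 0 ≤ m := by positivity
      have hm1 : m ≤ 1 := min_le_right _ _
      have hs := Real.abs_sin_le_one (Real.pi / x)
      have h1 : confine (m * Real.sin (Real.pi / x)) = 0 := by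
        apply confine_eq_zero
        rw [abs_mul, abs_of_nonneg hm0]
        nlinarith [abs_nonneg (Real.sin (Real.pi / x))]
      have h2 : fibreMin x ≤ 0 := fibreMin_nonpos (h.le.trans (min_le_right _ _))
      have h3 : planeF x (m * Real.sin (Real.pi / x)) ≤ a := by
        unfold planeF
        split_ifs with h0
        · exact ha.le
        · refine le_trans ?_ (hδ' x (h.trans_le (min_le_left _ _)))
          rw [bumpTheta_of_pos (abs_pos.2 h0), sq_abs]
          refine mul_le_of_le_one_right (Real.exp_pos _).le ?_
          rw [sq_le_one_iff_abs_le_one,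
            show m * Real.sin (Real.pi / x) - Real.sin (Real.pi / x)
              = (m - 1) * Real.sin (Real.pi / x) by ring, abs_mul]
          exact mul_le_one₀ (abs_le.2 ⟨by linarith, by linarith⟩) (abs_nonneg _) hs
      rw [planeH_eq, h1]
      linarith
  refine contractibleSpace_of_section (B := {x | fibreMin x ≤ a}) (fibreMin_ordConnected a)
    ⟨0, (fibreMin_nonpos (by simp)).trans ha.le⟩ (continuous_damped_sin δ').continuousOn
    (fun p hp => (fibreMin_le_planeH _ _).trans hp) (fun x hx => key x hx) fun p hp z hz => ?_
  exact le_of_mem_uIcc_of_star (φ := planeH p.1) (fun _ _ => planeH_le_of_mem_uIcc) hp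
    (key _ ((fibreMin_le_planeH _ _).trans hp)) hz

/-! ### The planar sublevel set at level zero -/

theorem contractibleSpace_planeH_zero (c : SignType) :
    ContractibleSpace {p : ℝ × ℝ | planeH p.1 p.2 ≤ 0 ∧ SignType.sign p.1 = c} := by
  have key : ∀ C : Set ℝ, (∀ x, SignType.sign x = c ↔ x ∈ C) →
      {p : ℝ × ℝ | planeH p.1 p.2 ≤ 0 ∧ SignType.sign p.1 = c}
        = {p | planeH p.1 p.2 ≤ 0 ∧ p.1 ∈ C} := fun C hC => by
    ext p
    exact and_congr_right fun _ => hC p.1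
  cases c
  · rw [key {0} fun x => sign_eq_zero_iff]
    exact contractibleSpace_planeH_over ordConnected_singleton
      (continuousOn_singleton _ _) rfl (fibreMin_nonpos (by simp))
  · rw [key (Iio 0) fun x => sign_eq_neg_one_iff]
    exact contractibleSpace_planeH_over ordConnected_Iio
      (continuousOn_sin_pi_div fun x hx => ne_of_lt hx) (x₀ := -1) (by simp)
      (fibreMin_nonpos (by norm_num))
  · rw [key (Ioi 0) fun x => sign_eq_one_iff]
    exact contractibleSpace_planeH_over ordConnected_Ioi
      (continuousOn_sin_pi_div fun x hx => ne_of_gt hx) (x₀ := 1) (by simp)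
      (fibreMin_nonpos (by norm_num))

theorem eq_sin_of_planeH_nonpos {x y : ℝ} (hx0 : x ≠ 0) (hx : x ≤ 1 / 2) (h : planeH x y ≤ 0) :
    y = Real.sin (Real.pi / x) := by
  rw [planeH_eq] at h
  have h1 : planeF x y = 0 := by
    linarith [planeF_nonneg x y, fibreMin_nonneg hx, confine_nonneg y]
  rw [planeF, if_neg hx0] at h1
  have := pow_eq_zero_iff two_ne_zero |>.1 ((mul_eq_zero.1 h1).resolve_left (Real.exp_pos _).ne')
  linarith

/-- Every interval with endpoint `0` contains points where `sin (π / x)` is a prescribed value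
of the sine. -/
theorem exists_sin_pi_div_eq {b : ℝ} (hb : b ≠ 0) (θ : ℝ) :
    ∃ x ∈ uIcc 0 b, x ≠ 0 ∧ Real.sin (Real.pi / x) = Real.sin θ := by
  rcases hb.lt_or_gt with hb | hb
  -- Shifting `θ` by enough full periods pushes `θ / π` beyond `b⁻¹`; its reciprocal is the required
  -- point between `0` and `b`.
  · obtain ⟨n, hn⟩ := exists_nat_gt ((|b⁻¹| * Real.pi + |θ|) / (2 * Real.pi))
    rw [div_lt_iff₀ (by positivity)] at hn
    have hθ := le_abs_self θ
    have hbi : b⁻¹ < 0 := inv_lt_zero.2 hb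
    rw [abs_of_neg hbi] at hn
    have hu : (θ - n * (2 * Real.pi)) / Real.pi < b⁻¹ := by
      rw [div_lt_iff₀ Real.pi_pos]
      linarith
    refine ⟨((θ - n * (2 * Real.pi)) / Real.pi)⁻¹, ?_, inv_ne_zero (hu.trans hbi).ne, ?_⟩
    · rw [uIcc_of_ge hb.le]
      refine ⟨?_, (inv_lt_zero.2 (hu.trans hbi)).le⟩
      have := (inv_le_inv_of_neg hbi (hu.trans hbi)).2 hu.le
      rwa [inv_inv] at this
    · rw [div_inv_eq_mul, mul_div_cancel₀ _ Real.pi_ne_zero, Real.sin_sub_nat_mul_two_pi]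
  · obtain ⟨n, hn⟩ := exists_nat_gt ((|b⁻¹| * Real.pi + |θ|) / (2 * Real.pi))
    rw [div_lt_iff₀ (by positivity)] at hn
    have hθ := neg_abs_le θ
    have hbi : 0 < b⁻¹ := inv_pos.2 hb
    rw [abs_of_pos hbi] at hn
    have hu : b⁻¹ < (θ + n * (2 * Real.pi)) / Real.pi := by
      rw [lt_div_iff₀ Real.pi_pos]
      linarith
    refine ⟨((θ + n * (2 * Real.pi)) / Real.pi)⁻¹, ?_, inv_ne_zero (hbi.trans hu).ne', ?_⟩
    · rw [uIcc_of_le hb.le]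
      exact ⟨(inv_pos.2 (hbi.trans hu)).le, inv_le_of_inv_le₀ hb hu.le⟩
    · rw [div_inv_eq_mul, mul_div_cancel₀ _ Real.pi_ne_zero, Real.sin_add_nat_mul_two_pi]

/-- The sign can only fail to be locally constant at a point over `x = 0`. A small connected
neighbourhood of such a point that also reaches some `x ≠ 0` covers a whole interval ending at `0`.
Over it the second coordinate equals `sin (π / x)` and takes both values `1` and `-1`, although it
varies by less than `1` from its value at the point. -/
theorem sign_fst_eq_of_continuous {T : Type*} [TopologicalSpace T] [PreconnectedSpace T]
    [LocallyConnectedSpace T] {γ : T → ℝ × ℝ} (hγ : Continuous γ)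
    (h : ∀ t, planeH (γ t).1 (γ t).2 ≤ 0) (s t : T) :
    SignType.sign (γ s).1 = SignType.sign (γ t).1 := by
  have hx : Continuous fun t => (γ t).1 := by fun_prop
  have hy : Continuous fun t => (γ t).2 := by fun_prop
  have hloc : IsLocallyConstant fun t => SignType.sign (γ t).1 := by
    rw [IsLocallyConstant.iff_eventually_eq]
    intro t₀
    rcases lt_trichotomy (γ t₀).1 0 with h0 | h0 | h0
    · filter_upwards [hx.continuousAt.eventually (gt_mem_nhds h0)] with t ht
      rw [sign_neg h0, sign_neg ht]
    -- The bound `1 / 2` keeps clear of the well around `x = 1`, so the zero sublevel set off the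
    -- axis is just the sine curve.
    · have hU : {t | (γ t).1 < 1 / 2 ∧ |(γ t).2 - (γ t₀).2| < 1} ∈ 𝓝 t₀ := by
        refine inter_mem (hx.continuousAt.eventually (gt_mem_nhds (by simp [h0]))) ?_
        have : Continuous fun t => |(γ t).2 - (γ t₀).2| := by fun_prop
        exact this.continuousAt.eventually (gt_mem_nhds (by simp))
      obtain ⟨V, hVU, hVo, hVt, hVc⟩ := locallyConnectedSpace_iff_subsets_isOpen_isConnected.1
        inferInstance t₀ _ hU
      filter_upwards [hVo.mem_nhds hVt] with t ht
      rw [h0]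
      by_cases ht0 : (γ t).1 = 0
      · rw [ht0]
      exfalso
      have hsub : uIcc 0 (γ t).1 ⊆ (fun t => (γ t).1) '' V :=
        (hVc.isPreconnected.image _ hx.continuousOn).ordConnected.uIcc_subset
          ⟨t₀, hVt, h0⟩ ⟨t, ht, rfl⟩
      have key : ∀ θ, |Real.sin θ - (γ t₀).2| < 1 := by
        intro θ
        obtain ⟨x, hxm, hx0, hxθ⟩ := exists_sin_pi_div_eq ht0 θ
        obtain ⟨r, hr, hrx⟩ := hsub hxm
        dsimp only at hrx
        have h1 := hVU hr
        have h2 := eq_sin_of_planeH_nonpos (hrx ▸ hx0) h1.1.le (h r)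
        rw [hrx, hxθ] at h2
        rw [← h2]
        exact h1.2
      have h1 := key (Real.pi / 2)
      have h2 := key (-(Real.pi / 2))
      rw [Real.sin_neg] at h2
      rw [Real.sin_pi_div_two] at h1 h2
      rw [abs_lt] at h1 h2
      linarith
    · filter_upwards [hx.continuousAt.eventually (lt_mem_nhds h0)] with t ht
      rw [sign_pos h0, sign_pos ht]
  exact hloc.apply_eq_of_preconnectedSpace s t

/-- The zeros `x = ±1 / (n + 1)` of `sin (π / x)` give points of the sine curve tending to the
origin from either side. -/
theorem zero_mem_closure_planeH_zero {c : ℝ} (hc : |c| = 1) :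
    (0 : ℝ × ℝ) ∈ closure {p : ℝ × ℝ | planeH p.1 p.2 ≤ 0 ∧ SignType.sign p.1 = SignType.sign c} := by
  have hc0 : c ≠ 0 := by rintro rfl; simp at hc
  have h0 : Tendsto (fun n : ℕ => c * (1 / ((n : ℝ) + 1))) atTop (𝓝 0) := by
    simpa using tendsto_one_div_add_atTop_nhds_zero_nat.const_mul c
  have ht : Tendsto (fun n : ℕ => ((c * (1 / ((n : ℝ) + 1)), 0) : ℝ × ℝ)) atTop (𝓝 0) :=
    h0.prodMk_nhds tendsto_const_nhds
  refine mem_closure_of_tendsto ht (Eventually.of_forall fun n => ⟨?_, ?_⟩)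
  · have hs : Real.sin (Real.pi / (c * (1 / ((n : ℝ) + 1)))) = 0 := by
      have : Real.pi / (c * (1 / ((n : ℝ) + 1))) = c⁻¹ * (((n + 1 : ℕ) : ℝ) * Real.pi) := by
        push_cast
        field_simp
      rw [this]
      rcases eq_or_eq_neg_of_abs_eq hc with rfl | rfl
      · rw [inv_one, one_mul, Real.sin_nat_mul_pi]
      · rw [inv_neg, inv_one, neg_one_mul, Real.sin_neg, Real.sin_nat_mul_pi, neg_zero]
    have h1 := planeH_sin (c * (1 / ((n : ℝ) + 1)))
    rw [hs] at h1
    rw [h1]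
    apply fibreMin_nonpos
    rw [abs_mul, hc, one_mul, abs_of_pos (by positivity), div_le_iff₀ (by positivity)]
    have : (0 : ℝ) ≤ n := n.cast_nonneg
    linarith
  · have : (0 : ℝ) < 1 / ((n : ℝ) + 1) := by positivity
    rw [sign_mul, sign_pos this, mul_one]

/-- Each of the parts `x < 0`, `x = 0`, `x > 0` is connected and has the origin in its closure, so
adding the origin keeps it connected and the three parts share a point. -/
theorem isConnected_planeH_zero : _root_.IsConnected {p : ℝ × ℝ | planeH p.1 p.2 ≤ 0} := by
  have hpart : ∀ c, _root_.IsConnected {p : ℝ × ℝ | planeH p.1 p.2 ≤ 0 ∧ SignType.sign p.1 = c} := by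
    intro c
    have := contractibleSpace_planeH_zero c
    exact isConnected_iff_connectedSpace.2 inferInstance
  have h0 : (0 : ℝ × ℝ) ∈ {p : ℝ × ℝ | planeH p.1 p.2 ≤ 0 ∧ SignType.sign p.1 = 0} := by
    refine ⟨?_, by simp⟩
    have := planeH_sin 0
    simp only [div_zero, Real.sin_zero] at this
    exact this.trans_le (fibreMin_nonpos (by simp))
  have hext : ∀ c : ℝ, |c| = 1 → IsPreconnected
      (insert 0 {p : ℝ × ℝ | planeH p.1 p.2 ≤ 0 ∧ SignType.sign p.1 = SignType.sign c}) :=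
    fun c hc => (hpart _).isPreconnected.subset_closure (subset_insert _ _)
      (insert_subset (zero_mem_closure_planeH_zero hc) subset_closure)
  refine ⟨⟨0, h0.1⟩, ?_⟩
  have hu₁ := (hpart 0).isPreconnected.union 0 h0 (mem_insert _ _) (hext 1 (by simp))
  have hu := IsPreconnected.union 0 (mem_union_left _ h0) (mem_insert _ _) hu₁
    (hext (-1) (by simp))
  convert hu using 1
  ext p
  simp only [mem_ofPred_eq, mem_union, mem_insert_iff]
  constructor
  · intro hp
    rcases lt_trichotomy p.1 0 with h | h | h
    · exact Or.inr (Or.inr ⟨hp, by rw [sign_neg h, sign_neg (by norm_num)]⟩)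
    · exact Or.inl (Or.inl ⟨hp, by rw [h, sign_zero]⟩)
    · exact Or.inl (Or.inr (Or.inr ⟨hp, by rw [sign_pos h, sign_pos (by norm_num)]⟩))
  · rintro ((h | rfl | h) | rfl | h)
    exacts [h.1, h0.1, h.1, h0.1, h.1]

/-! ### Spaces whose path components are labelled by signs -/

theorem joined_iff_of_label {X κ : Type*} [TopologicalSpace X] (l : X → κ)
    (hfib : ∀ c, ContractibleSpace {x // l x = c}) (hpath : ∀ x y, Joined x y → l x = l y)
    (x y : X) : Joined x y ↔ l x = l y := by
  refine ⟨hpath x y, fun h => ?_⟩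
  have := hfib (l y)
  exact (PathConnectedSpace.joined (X := {x // l x = l y}) ⟨x, h⟩ ⟨y, rfl⟩).map
    continuous_subtype_val

theorem card_zerothHomotopy_of_label {X κ : Type*} [TopologicalSpace X] (l : X → κ)
    (hfib : ∀ c, ContractibleSpace {x // l x = c}) (hpath : ∀ x y, Joined x y → l x = l y) :
    Nat.card (ZerothHomotopy X) = Nat.card κ := by
  refine Nat.card_congr (Equiv.ofBijective (Quotient.lift l hpath) ⟨?_, fun c => ?_⟩)
  · rintro ⟨x⟩ ⟨y⟩ h
    exact Quotient.sound ((joined_iff_of_label l hfib hpath x y).2 h)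
  · obtain ⟨x⟩ : Nonempty {x // l x = c} := inferInstance
    exact ⟨Quotient.mk _ x.1, x.2⟩

theorem contractibleSpace_pathComponent_of_label {X κ : Type*} [TopologicalSpace X] (l : X → κ)
    (hfib : ∀ c, ContractibleSpace {x // l x = c}) (hpath : ∀ x y, Joined x y → l x = l y)
    (x : X) : ContractibleSpace (pathComponent x) := by
  have := hfib (l x)
  have e : pathComponent x = {y | l y = l x} := by
    ext y
    exact (joined_iff_of_label l hfib hpath x y).trans eq_comm
  rw [e]
  exact this

/-! ### Stereographic coordinates on the sphere -/

theorem sphere_sq_add_sq_add_sq (w : S2) : w.1 0 ^ 2 + w.1 1 ^ 2 + w.1 2 ^ 2 = 1 := by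
  have h := w.2
  rw [mem_sphere_zero_iff_norm, EuclideanSpace.norm_eq, Real.sqrt_eq_one] at h
  simpa [Fin.sum_univ_three] using h

theorem one_sub_pos_of_ne_northPole {w : S2} (hw : w ≠ northPole) : 0 < 1 - w.1 2 := by
  have h := sphere_sq_add_sq_add_sq w
  have hle : w.1 2 ≤ 1 := by nlinarith [sq_nonneg (w.1 0), sq_nonneg (w.1 1)]
  refine (sub_nonneg.2 hle).lt_of_ne fun h0 => hw ?_
  have h2 : w.1 2 = 1 := by linarith
  rw [h2] at h
  have h00 : w.1 0 = 0 := by nlinarith [sq_nonneg (w.1 0), sq_nonneg (w.1 1)]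
  have h01 : w.1 1 = 0 := by nlinarith [sq_nonneg (w.1 0), sq_nonneg (w.1 1)]
  ext i
  fin_cases i <;> simp [northPole, h00, h01, h2]

/-- The inverse of the stereographic projection from the north pole. -/
noncomputable def invStereo (p : ℝ × ℝ) : S2 :=
  ⟨!₂[2 * p.1 / (p.1 ^ 2 + p.2 ^ 2 + 1), 2 * p.2 / (p.1 ^ 2 + p.2 ^ 2 + 1),
    (p.1 ^ 2 + p.2 ^ 2 - 1) / (p.1 ^ 2 + p.2 ^ 2 + 1)], by
    have : p.1 ^ 2 + p.2 ^ 2 + 1 ≠ 0 := by positivity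
    rw [mem_sphere_zero_iff_norm, EuclideanSpace.norm_eq, Real.sqrt_eq_one]
    simp only [Fin.sum_univ_three, Real.norm_eq_abs, sq_abs]
    simp
    field_simp
    ring⟩

/-- Stereographic projection from the north pole. -/
noncomputable def stereo (w : S2) : ℝ × ℝ := (w.1 0 / (1 - w.1 2), w.1 1 / (1 - w.1 2))

theorem continuous_invStereo : Continuous invStereo := by
  have h : ∀ p : ℝ × ℝ, p.1 ^ 2 + p.2 ^ 2 + 1 ≠ 0 := fun p => by positivity
  refine Continuous.subtype_mk ((PiLp.continuous_toLp 2 _).comp (continuous_pi fun i => ?_)) _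
  fin_cases i
  · exact Continuous.div (by fun_prop) (by fun_prop) h
  · exact Continuous.div (by fun_prop) (by fun_prop) h
  · exact Continuous.div (by fun_prop) (by fun_prop) h

theorem one_sub_invStereo (p : ℝ × ℝ) :
    1 - (invStereo p).1 2 = 2 / (p.1 ^ 2 + p.2 ^ 2 + 1) := by
  have : p.1 ^ 2 + p.2 ^ 2 + 1 ≠ 0 := by positivity
  simp [invStereo]
  field_simp
  ring

theorem stereo_invStereo (p : ℝ × ℝ) : stereo (invStereo p) = p := by
  have : p.1 ^ 2 + p.2 ^ 2 + 1 ≠ 0 := by positivity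
  ext
  · rw [stereo, one_sub_invStereo]
    simp [invStereo]
    field_simp
  · rw [stereo, one_sub_invStereo]
    simp [invStereo]
    field_simp

theorem invStereo_ne_northPole (p : ℝ × ℝ) : invStereo p ≠ northPole := by
  intro h
  have h1 := one_sub_invStereo p
  rw [h] at h1
  have : 0 < 2 / (p.1 ^ 2 + p.2 ^ 2 + 1) := by positivity
  simp [northPole] at h1
  linarith

theorem stereo_sq_add_sq {w : S2} (hw : w ≠ northPole) :
    (stereo w).1 ^ 2 + (stereo w).2 ^ 2 + 1 = 2 / (1 - w.1 2) := by
  have h := one_sub_pos_of_ne_northPole hw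
  have h2 := sphere_sq_add_sq_add_sq w
  simp only [stereo]
  field_simp
  linarith

theorem invStereo_stereo {w : S2} (hw : w ≠ northPole) : invStereo (stereo w) = w := by
  have h := one_sub_pos_of_ne_northPole hw
  have h3 := stereo_sq_add_sq hw
  have h4 : (stereo w).1 ^ 2 + (stereo w).2 ^ 2 - 1 = 2 / (1 - w.1 2) - 2 := by linarith
  ext i
  fin_cases i
  · simp [invStereo, h3]
    simp [stereo]
    field_simp
  · simp [invStereo, h3]
    simp [stereo]
    field_simp
  · simp [invStereo, h3, h4]
    field_simp
    ring

theorem sphereH_eq (w : S2) : sphereH w = planeH (stereo w).1 (stereo w).2 := rfl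

/-! ### Existence of cutoffs -/

theorem abs_lt_three_of_planeH_le_one {x y : ℝ} (h : planeH x y ≤ 1) : |x| < 3 ∧ |y| < 3 := by
  have hθ : bumpTheta (1 / 4 - (x - 1) ^ 2) ≤ 1 := by
    unfold bumpTheta
    split_ifs with h0
    · rw [Real.exp_le_one_iff, neg_div]
      exact neg_nonpos.2 (by positivity)
    · exact zero_le_one
  have h1 : confine x + confine y ≤ 2 := by
    rw [planeH_eq, fibreMin] at h
    linarith [planeF_nonneg x y]
  have key : ∀ t : ℝ, 3 ≤ |t| → 2 < confine t := by
    intro t ht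
    have h3 : confine 3 ≤ confine t := confine_le (le_max_of_le_right (by rwa [abs_of_pos three_pos]))
    refine lt_of_lt_of_le ?_ h3
    rw [confine, bumpTheta_of_pos (by norm_num)]
    -- This gives `confine 3 = 9 exp (-1/25) ≥ 9 · 24/25 > 2`.
    have := Real.add_one_le_exp (-1 / (3 ^ 2 - 4 : ℝ) ^ 2)
    norm_num at this ⊢
    linarith
  constructor
  · by_contra! hx
    linarith [key x hx, confine_nonneg y]
  · by_contra! hy
    linarith [key y hy, confine_nonneg x]

/-- On `K` both planar coordinates are below `3` in absolute value, so `2 / (1 - z) = |p|² + 1 <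
19`. -/
theorem height_le_of_mem_compactK {w : S2} (hw : w ∈ compactK) : w.1 2 ≤ 17 / 19 := by
  have h := one_sub_pos_of_ne_northPole hw.1
  obtain ⟨h1, h2⟩ := abs_lt_three_of_planeH_le_one (sphereH_eq w ▸ hw.2)
  have h3 := stereo_sq_add_sq hw.1
  have h4 : (stereo w).1 ^ 2 < 3 ^ 2 := sq_lt_sq.2 (by simpa using h1)
  have h5 : (stereo w).2 ^ 2 < 3 ^ 2 := sq_lt_sq.2 (by simpa using h2)
  have h6 : 2 / (1 - w.1 2) < 19 := by linarith
  rw [div_lt_iff₀ h] at h6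
  linarith

theorem contMDiff_coe_S2 :
    ContMDiff (𝓡 2) 𝓘(ℝ, EuclideanSpace ℝ (Fin 3)) ∞ (Subtype.val : S2 → EuclideanSpace ℝ (Fin 3)) :=
  haveI := Fact.mk (@finrank_euclideanSpace_fin ℝ _ (2 + 1))
  contMDiff_coe_sphere

theorem contDiff_coord {n : ℕ} (i : Fin n) : ContDiff ℝ ∞ fun v : EuclideanSpace ℝ (Fin n) => v i :=
  (EuclideanSpace.proj i : EuclideanSpace ℝ (Fin n) →L[ℝ] ℝ).contDiff

theorem exists_isCutoff : ∃ η : S2 → ℝ, IsCutoff η := by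
  -- The affine argument is `1` at height `17/19`, which bounds `K`, and `0` at height `18/19`.
  refine ⟨fun w => Real.smoothTransition (18 - 19 * w.1 2), ?_, fun w => ⟨?_, ?_⟩, ?_, fun w hw => ?_⟩
  · have h : ContDiff ℝ ∞ fun v : EuclideanSpace ℝ (Fin 3) => Real.smoothTransition (18 - 19 * v 2) :=
      Real.smoothTransition.contDiff.comp (contDiff_const.sub (contDiff_const.mul (contDiff_coord 2)))
    exact h.contMDiff.comp contMDiff_coe_S2
  · exact Real.smoothTransition.nonneg _
  · exact Real.smoothTransition.le_one _
  · have hc : Continuous fun w : S2 => w.1 2 := by fun_prop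
    have h0 : (northPole.1 2 : ℝ) = 1 := by simp [northPole]
    filter_upwards [hc.continuousAt.eventually (lt_mem_nhds (a := 18 / 19) (show (18 / 19 : ℝ) < northPole.1 2 by rw [h0]; norm_num))]
      with w hw
    exact Real.smoothTransition.zero_of_nonpos (by linarith)
  · exact Real.smoothTransition.one_of_one_le (by linarith [height_le_of_mem_compactK hw])

/-! ### Smoothness of the function on the sphere -/

theorem bigH_contMDiff {η : S2 → ℝ} (hη : IsCutoff η) : ContMDiff (𝓡 2) 𝓘(ℝ, ℝ) ∞ (bigH η) := by
  intro w
  by_cases hw : w = northPole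
  · subst hw
    refine (contMDiffAt_const (c := (1 : ℝ))).congr_of_eventuallyEq ?_
    filter_upwards [hη.eventually_eq_zero] with w hw
    unfold bigH
    split_ifs
    · rfl
    · rw [hw]
      ring
  · have hG : ContDiffAt ℝ ∞ (fun v : EuclideanSpace ℝ (Fin 3) =>
        planeH (v 0 / (1 - v 2)) (v 1 / (1 - v 2))) w.1 := by
      have hne := (one_sub_pos_of_ne_northPole hw).ne'
      have hd := (contDiffAt_const (x := w.1) (c := (1 : ℝ))).sub (contDiff_coord (n := 3) 2).contDiffAt
      exact planeH_contDiff.contDiffAt.comp w.1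
        (((contDiff_coord 0).contDiffAt.div hd hne).prodMk
          ((contDiff_coord 1).contDiffAt.div hd hne))
    have hS : ContMDiffAt (𝓡 2) 𝓘(ℝ, ℝ) ∞ sphereH w := hG.contMDiffAt.comp w contMDiff_coe_S2.contMDiffAt
    have hη' := hη.smooth.contMDiffAt (x := w)
    refine ((hS.mul hη').add (contMDiffAt_const (c := (1 : ℝ)) |>.sub hη')).congr_of_eventuallyEq ?_
    filter_upwards [isOpen_ne.mem_nhds hw] with v hv
    exact if_neg hv

/-! ### The surface and its sublevel sets -/

/-- `H` is a convex combination of `h ∘ p` and `1`: outside `K` both are at least `1`, and on `K`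
the cutoff is `1`. Hence sublevel sets below `1` do not depend on `η`. -/
theorem bigH_le_iff {η : S2 → ℝ} (hη : IsCutoff η) {a : ℝ} (ha : a < 1) (w : S2) :
    bigH η w ≤ a ↔ w ≠ northPole ∧ sphereH w ≤ a := by
  unfold bigH
  split_ifs with hw
  · simp [hw, ha]
  · simp only [ne_eq, hw, not_false_eq_true, true_and]
    by_cases h : sphereH w ≤ 1
    · rw [hη.eq_one w ⟨hw, h⟩]
      simp
    · obtain ⟨h0, h1⟩ := hη.mem_Icc w
      push Not at h
      refine iff_of_false ?_ ?_ <;> push Not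
      · nlinarith
      · linarith

theorem graphEmb_continuous {η : S2 → ℝ} (hη : IsCutoff η) : Continuous (graphEmb η) := by
  have hH := (bigH_contMDiff hη).continuous
  refine (PiLp.continuous_toLp 2 _).comp (continuous_pi fun i => ?_)
  fin_cases i
  · exact (by fun_prop : Continuous fun w : S2 => w.1 0)
  · exact (by fun_prop : Continuous fun w : S2 => w.1 1)
  · exact (by fun_prop : Continuous fun w : S2 => w.1 2)
  · exact hH

theorem graphEmb_injective (η : S2 → ℝ) : Function.Injective (graphEmb η) := by
  intro v w h
  have h0 := congrArg (fun q : EuclideanSpace ℝ (Fin 4) => q 0) h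
  have h1 := congrArg (fun q : EuclideanSpace ℝ (Fin 4) => q 1) h
  have h2 := congrArg (fun q : EuclideanSpace ℝ (Fin 4) => q 2) h
  simp [graphEmb] at h0 h1 h2
  ext i
  fin_cases i
  exacts [h0, h1, h2]

theorem graphEmb_isEmbedding {η : S2 → ℝ} (hη : IsCutoff η) : IsEmbedding (graphEmb η) :=
  ((graphEmb_continuous hη).isClosedEmbedding (graphEmb_injective η)).isEmbedding

theorem height_graphEmb (η : S2 → ℝ) (w : S2) : height η ⟨graphEmb η w, w, rfl⟩ = bigH η w := by
  simp [height, graphEmb]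

theorem coords_of_mem_sublevel {η : S2 → ℝ} (hη : IsCutoff η) {a : ℝ} (ha : a < 1)
    (q : sublevel (height η) a) : ∃ w : S2, w ≠ northPole ∧ q.1.1 = graphEmb η w ∧ sphereH w ≤ a := by
  obtain ⟨⟨_, w, rfl⟩, hq⟩ := q
  have h : bigH η w ≤ a := height_graphEmb η w ▸ hq
  rw [bigH_le_iff hη ha] at h
  exact ⟨w, h.1, rfl, h.2⟩

/-- For `a < 1` the sublevel set of the height function is homeomorphic to the planar one. -/
noncomputable def sublevelHomeo {η : S2 → ℝ} (hη : IsCutoff η) {a : ℝ} (ha : a < 1) :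
    sublevel (height η) a ≃ₜ {p : ℝ × ℝ | planeH p.1 p.2 ≤ a} where
  toFun q := ⟨(q.1.1 0 / (1 - q.1.1 2), q.1.1 1 / (1 - q.1.1 2)), by
    obtain ⟨w, -, hqw, h⟩ := coords_of_mem_sublevel hη ha q
    simpa [hqw, graphEmb, sphereH] using h⟩
  invFun p := ⟨⟨graphEmb η (invStereo p.1), invStereo p.1, rfl⟩, by
    change height η _ ≤ a
    rw [height_graphEmb, bigH_le_iff hη ha]
    exact ⟨invStereo_ne_northPole p.1, by rw [sphereH_eq, stereo_invStereo]; exact p.2⟩⟩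
  left_inv q := by
    obtain ⟨w, hw, hqw, -⟩ := coords_of_mem_sublevel hη ha q
    apply Subtype.ext
    apply Subtype.ext
    have h := invStereo_stereo hw
    simp only [stereo] at h
    simp only [hqw, graphEmb]
    simp [h]
  right_inv p := by
    apply Subtype.ext
    have h := stereo_invStereo p.1
    simp only [stereo] at h
    simpa [graphEmb] using h
  continuous_toFun := by
    have h : ∀ q : sublevel (height η) a, 1 - q.1.1 2 ≠ 0 := fun q => by
      obtain ⟨w, hw, hqw, -⟩ := coords_of_mem_sublevel hη ha q
      rw [hqw]
      simpa [graphEmb] using (one_sub_pos_of_ne_northPole hw).ne'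
    exact ((Continuous.div (by fun_prop) (by fun_prop) h).prodMk
      (Continuous.div (by fun_prop) (by fun_prop) h)).subtype_mk _
  continuous_invFun :=
    ((((graphEmb_continuous hη).comp continuous_invStereo).comp
      continuous_subtype_val).subtype_mk _).subtype_mk _

theorem contractibleSpace_sublevel {η : S2 → ℝ} (hη : IsCutoff η) {a : ℝ}
    (ha : a ∈ Ico (-Real.exp (-16)) 1) (ha0 : a ≠ 0) : ContractibleSpace (sublevel (height η) a) := by
  have : ContractibleSpace {p : ℝ × ℝ | planeH p.1 p.2 ≤ a} := by
    rcases ha0.lt_or_gt with h | h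
    · exact contractibleSpace_planeH_of_neg ⟨ha.1, h⟩
    · exact contractibleSpace_planeH_of_pos h
  exact (sublevelHomeo hη ha.2).contractibleSpace

theorem connectedSpace_sublevel_zero {η : S2 → ℝ} (hη : IsCutoff η) :
    ConnectedSpace (sublevel (height η) 0) := by
  have := isConnected_iff_connectedSpace.1 isConnected_planeH_zero
  exact (sublevelHomeo hη zero_lt_one).symm.surjective.connectedSpace
    (sublevelHomeo hη zero_lt_one).symm.continuous

/-- The label of the path component of a point: the sign of its first stereographic coordinate. -/
noncomputable def componentLabel {η : S2 → ℝ} (hη : IsCutoff η) (q : sublevel (height η) 0) : SignType :=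
  SignType.sign (sublevelHomeo hη zero_lt_one q).1.1

theorem contractibleSpace_componentLabel {η : S2 → ℝ} (hη : IsCutoff η) (c : SignType) :
    ContractibleSpace {q // componentLabel hη q = c} := by
  have := contractibleSpace_planeH_zero c
  let e₁ : {q // componentLabel hη q = c} ≃ₜ
      {p : {p : ℝ × ℝ | planeH p.1 p.2 ≤ 0} // SignType.sign p.1.1 = c} :=
    (sublevelHomeo hη zero_lt_one).subtype fun _ => Iff.rfl
  let e₂ : {p : {p : ℝ × ℝ | planeH p.1 p.2 ≤ 0} // SignType.sign p.1.1 = c} ≃ₜ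
      {p : ℝ × ℝ | planeH p.1 p.2 ≤ 0 ∧ SignType.sign p.1 = c} :=
    { toFun := fun p => ⟨p.1.1, p.1.2, p.2⟩
      invFun := fun p => ⟨⟨p.1, p.2.1⟩, p.2.2⟩
      left_inv := fun _ => rfl
      right_inv := fun _ => rfl
      continuous_toFun := by fun_prop
      continuous_invFun := by fun_prop }
  exact (e₁.trans e₂).contractibleSpace

theorem componentLabel_eq_of_joined {η : S2 → ℝ} (hη : IsCutoff η) (q r : sublevel (height η) 0)
    (h : Joined q r) : componentLabel hη q = componentLabel hη r := by
  obtain ⟨γ⟩ := h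
  have := sign_fst_eq_of_continuous
    (γ := fun t => (sublevelHomeo hη zero_lt_one (γ.extend t)).1)
    (continuous_subtype_val.comp ((sublevelHomeo hη zero_lt_one).continuous.comp γ.continuous_extend))
    (fun t => (sublevelHomeo hη zero_lt_one (γ.extend t)).2) 0 1
  simpa [componentLabel] using this

/-! ### The graph map is an immersion -/

/-- The projection `ℝ⁴ → ℝ³` forgetting the last coordinate. -/
noncomputable def dropLast (v : EuclideanSpace ℝ (Fin 4)) : EuclideanSpace ℝ (Fin 3) :=
  !₂[v 0, v 1, v 2]

/-- The map `ℝ³ × ℝ → ℝ⁴`. -/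
noncomputable def appendLast (v : EuclideanSpace ℝ (Fin 3)) (t : ℝ) : EuclideanSpace ℝ (Fin 4) :=
  !₂[v 0, v 1, v 2, t]

theorem dropLast_contDiff : ContDiff ℝ ∞ dropLast := by
  rw [contDiff_euclidean]
  intro i
  fin_cases i
  exacts [contDiff_coord 0, contDiff_coord 1, contDiff_coord 2]

theorem contDiff_appendLast {E : Type*} [NormedAddCommGroup E] [NormedSpace ℝ E]
    {f : E → EuclideanSpace ℝ (Fin 3)} {g : E → ℝ} (hf : ContDiff ℝ ∞ f) (hg : ContDiff ℝ ∞ g) :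
    ContDiff ℝ ∞ fun x => appendLast (f x) (g x) := by
  rw [contDiff_euclidean]
  intro i
  fin_cases i
  exacts [(contDiff_coord (n := 3) 0).comp hf, (contDiff_coord (n := 3) 1).comp hf, (contDiff_coord (n := 3) 2).comp hf, hg]

@[simp]
theorem dropLast_appendLast (v : EuclideanSpace ℝ (Fin 3)) (t : ℝ) :
    dropLast (appendLast v t) = v := by
  ext i
  fin_cases i <;> simp [dropLast, appendLast]

@[simp]
theorem appendLast_last (v : EuclideanSpace ℝ (Fin 3)) (t : ℝ) : appendLast v t 3 = t := by
  simp [appendLast]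

@[simp]
theorem appendLast_dropLast (v : EuclideanSpace ℝ (Fin 4)) : appendLast (dropLast v) (v 3) = v := by
  ext i
  fin_cases i <;> simp [dropLast, appendLast]

theorem graphEmb_eq_appendLast (η : S2 → ℝ) (w : S2) : graphEmb η w = appendLast w.1 (bigH η w) := rfl

/-- The radial extension of the standard chart of the sphere at `w` to an open cone in `ℝ³`. -/
noncomputable def coneChart (w : S2) (v : EuclideanSpace ℝ (Fin 3)) : EuclideanSpace ℝ (Fin 2) :=
  haveI := Fact.mk (@finrank_euclideanSpace_fin ℝ _ (2 + 1))
  (OrthonormalBasis.fromOrthogonalSpanSingleton 2 (ne_zero_of_mem_unit_sphere (-w))).repr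
    (stereoToFun (-w).1 (‖v‖⁻¹ • v))

theorem coneChart_coe (w x : S2) :
    coneChart w x.1 = chartAt (EuclideanSpace ℝ (Fin 2)) w x := by
  have h : ‖x.1‖⁻¹ • x.1 = x.1 := by rw [norm_eq_of_mem_sphere x, inv_one, one_smul]
  rw [coneChart, h]
  rfl

theorem coneChart_smul (w : S2) (v : EuclideanSpace ℝ (Fin 3)) {r : ℝ} (hr : 0 < r) :
    coneChart w (r • v) = coneChart w v := by
  rw [coneChart, coneChart, norm_smul, Real.norm_of_nonneg hr.le, smul_smul, mul_inv_rev, mul_assoc,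
    inv_mul_cancel₀ hr.ne', mul_one]

/-- The open cone on which `coneChart w` is a submersion. -/
def chartCone (w : S2) : Set (EuclideanSpace ℝ (Fin 3)) := {v | inner ℝ (-w).1 v ≠ ‖v‖}

theorem isOpen_chartCone (w : S2) : IsOpen (chartCone w) :=
  isOpen_ne_fun (by fun_prop) (by fun_prop)

theorem ne_zero_of_mem_chartCone {w : S2} {v : EuclideanSpace ℝ (Fin 3)} (hv : v ∈ chartCone w) :
    v ≠ 0 := by
  rintro rfl
  simp [chartCone] at hv

theorem smul_mem_chartCone {w : S2} {v : EuclideanSpace ℝ (Fin 3)} {r : ℝ} (hr : 0 < r)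
    (hv : v ∈ chartCone w) : r • v ∈ chartCone w := by
  have : inner ℝ (-w).1 v ≠ ‖v‖ := hv
  rw [chartCone, mem_ofPred_eq, inner_smul_right, norm_smul, Real.norm_of_nonneg hr.le]
  exact fun h => this (mul_left_cancel₀ hr.ne' h)

theorem coneChart_contDiffOn (w : S2) : ContDiffOn ℝ ∞ (coneChart w) (chartCone w) := by
  have := Fact.mk (@finrank_euclideanSpace_fin ℝ _ (2 + 1))
  refine (OrthonormalBasis.fromOrthogonalSpanSingleton (𝕜 := ℝ) 2
    (ne_zero_of_mem_unit_sphere (-w))).repr.contDiff.comp_contDiffOn ?_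
  refine contDiffOn_stereoToFun.comp (t := {x | innerSL ℝ (-w).1 x ≠ (1 : ℝ)}) ?_ ?_
  · intro v hv
    have h0 := ne_zero_of_mem_chartCone hv
    exact (((contDiffAt_norm ℝ h0).inv (norm_ne_zero_iff.2 h0)).smul contDiffAt_id).contDiffWithinAt
  · intro v hv
    have h0 := norm_ne_zero_iff.2 (ne_zero_of_mem_chartCone hv)
    have : inner ℝ (-w).1 v ≠ ‖v‖ := hv
    rw [mem_ofPred_eq, innerSL_apply_apply, inner_smul_right]
    intro h
    apply this
    field_simp at h
    exact h

/-- The inverse of the standard chart of the sphere at `w`. -/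
noncomputable def chartInv (w : S2) (u : EuclideanSpace ℝ (Fin 2)) : S2 :=
  (chartAt (EuclideanSpace ℝ (Fin 2)) w).symm u

theorem chartAt_S2_source (w : S2) : (chartAt (EuclideanSpace ℝ (Fin 2)) w).source = {-w}ᶜ :=
  haveI := Fact.mk (@finrank_euclideanSpace_fin ℝ _ (2 + 1))
  stereographic'_source (n := 2) (-w)

theorem chartAt_S2_target (w : S2) : (chartAt (EuclideanSpace ℝ (Fin 2)) w).target = univ :=
  haveI := Fact.mk (@finrank_euclideanSpace_fin ℝ _ (2 + 1))
  stereographic'_target (n := 2) (-w)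

theorem mem_chartCone_iff (w x : S2) : x.1 ∈ chartCone w ↔ x ≠ -w := by
  rw [chartCone, mem_ofPred_eq, norm_eq_of_mem_sphere x, ne_eq, ne_eq, ← sphere_ext_iff, eq_comm]

theorem chartInv_mem_chartCone (w : S2) (u : EuclideanSpace ℝ (Fin 2)) :
    (chartInv w u).1 ∈ chartCone w := by
  rw [mem_chartCone_iff]
  have := (chartAt (EuclideanSpace ℝ (Fin 2)) w).map_target (x := u)
    (by rw [chartAt_S2_target]; trivial)
  rw [chartAt_S2_source] at this
  exact this

theorem coneChart_chartInv (w : S2) (u : EuclideanSpace ℝ (Fin 2)) :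
    coneChart w (chartInv w u).1 = u := by
  rw [coneChart_coe]
  exact (chartAt (EuclideanSpace ℝ (Fin 2)) w).right_inv (by rw [chartAt_S2_target]; trivial)

theorem chartInv_coneChart {w : S2} {v : EuclideanSpace ℝ (Fin 3)} (hv : v ∈ chartCone w) :
    (chartInv w (coneChart w v)).1 = ‖v‖⁻¹ • v := by
  have h0 := norm_pos_iff.2 (ne_zero_of_mem_chartCone hv)
  have hx : ‖v‖⁻¹ • v ∈ Metric.sphere (0 : EuclideanSpace ℝ (Fin 3)) 1 := by
    rw [mem_sphere_zero_iff_norm, norm_smul, norm_inv, norm_norm, inv_mul_cancel₀ h0.ne']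
  have h1 : coneChart w v = chartAt (EuclideanSpace ℝ (Fin 2)) w ⟨_, hx⟩ := by
    rw [← coneChart_coe, coneChart_smul w v (inv_pos.2 h0)]
  rw [h1, chartInv, OpenPartialHomeomorph.left_inv]
  rw [chartAt_S2_source]
  exact (mem_chartCone_iff w _).1 (smul_mem_chartCone (inv_pos.2 h0) hv)

theorem chartInv_contMDiff (w : S2) : ContMDiff (𝓡 2) (𝓡 2) ∞ (chartInv w) := by
  have h := contMDiffOn_chart_symm (I := 𝓡 2) (n := ∞) (x := w)
  rwa [chartAt_S2_target, contMDiffOn_univ] at h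

theorem coe_chartInv_contDiff (w : S2) : ContDiff ℝ ∞ fun u => (chartInv w u).1 :=
  (contMDiff_coe_S2.comp (chartInv_contMDiff w)).contDiff

/-- A chart of `ℝ⁴` that straightens the graph of a function `g` on the sphere near `w`. -/
noncomputable def graphChart (w : S2) {g : S2 → ℝ} (hg : ContMDiff (𝓡 2) 𝓘(ℝ, ℝ) ∞ g) :
    OpenPartialHomeomorph (EuclideanSpace ℝ (Fin 4)) (EuclideanSpace ℝ (Fin 2) × (ℝ × ℝ)) where
  toFun v := (coneChart w (dropLast v),
    (‖dropLast v‖ - 1, v 3 - g (chartInv w (coneChart w (dropLast v)))))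
  invFun q := appendLast ((1 + q.2.1) • (chartInv w q.1).1) (q.2.2 + g (chartInv w q.1))
  source := dropLast ⁻¹' chartCone w
  target := {q | -1 < q.2.1}
  map_source' v hv := by
    have := norm_pos_iff.2 (ne_zero_of_mem_chartCone hv)
    change -1 < ‖dropLast v‖ - 1
    linarith
  map_target' q hq := by
    have hq' : 0 < 1 + q.2.1 := by linarith [show -1 < q.2.1 from hq]
    rw [mem_preimage, dropLast_appendLast]
    exact smul_mem_chartCone hq' (chartInv_mem_chartCone w q.1)
  left_inv' v hv := by
    have h0 := norm_ne_zero_iff.2 (ne_zero_of_mem_chartCone hv)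
    simp only
    rw [chartInv_coneChart hv, smul_smul, add_sub_cancel, mul_inv_cancel₀ h0, one_smul,
      sub_add_cancel, appendLast_dropLast]
  right_inv' q hq := by
    have hq' : 0 < 1 + q.2.1 := by linarith [show -1 < q.2.1 from hq]
    simp only [dropLast_appendLast, appendLast_last]
    rw [coneChart_smul w _ hq', coneChart_chartInv, norm_smul, Real.norm_of_nonneg hq'.le,
      norm_eq_of_mem_sphere, mul_one, add_sub_cancel_left, add_sub_cancel_right]
  open_source := (isOpen_chartCone w).preimage dropLast_contDiff.continuous
  open_target := isOpen_lt continuous_const (by fun_prop)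
  continuousOn_toFun := by
    have h1 : ContinuousOn (fun v => coneChart w (dropLast v)) (dropLast ⁻¹' chartCone w) :=
      (coneChart_contDiffOn w).continuousOn.comp dropLast_contDiff.continuous.continuousOn
        (mapsTo_preimage _ _)
    have h2 : Continuous fun v => ‖dropLast v‖ - 1 := by
      have := dropLast_contDiff.continuous
      fun_prop
    exact h1.prodMk (h2.continuousOn.prodMk ((contDiff_coord 3).continuous.continuousOn.sub
      ((hg.continuous.comp (chartInv_contMDiff w).continuous).comp_continuousOn h1)))
  continuousOn_invFun := by
    have h := (coe_chartInv_contDiff w).comp (contDiff_fst (E := EuclideanSpace ℝ (Fin 2)) (F := ℝ × ℝ))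
    have h2 := (hg.comp (chartInv_contMDiff w)).contDiff.comp
      (contDiff_fst (E := EuclideanSpace ℝ (Fin 2)) (F := ℝ × ℝ))
    exact (contDiff_appendLast ((contDiff_const.add (contDiff_fst.comp contDiff_snd)).smul h)
      ((contDiff_snd.comp contDiff_snd).add h2)).continuous.continuousOn

theorem graphChart_contDiffOn (w : S2) {g : S2 → ℝ} (hg : ContMDiff (𝓡 2) 𝓘(ℝ, ℝ) ∞ g) :
    ContDiffOn ℝ ∞ (graphChart w hg) (graphChart w hg).source := by
  have h1 : ContDiffOn ℝ ∞ (fun v => coneChart w (dropLast v)) (dropLast ⁻¹' chartCone w) :=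
    (coneChart_contDiffOn w).comp dropLast_contDiff.contDiffOn (mapsTo_preimage _ _)
  have h2 : ContDiffOn ℝ ∞ (fun v => ‖dropLast v‖ - 1) (dropLast ⁻¹' chartCone w) :=
    (dropLast_contDiff.contDiffOn.norm ℝ fun v hv => ne_zero_of_mem_chartCone hv).sub contDiffOn_const
  exact h1.prodMk (h2.prodMk ((contDiff_coord 3).contDiffOn.sub
    ((hg.comp (chartInv_contMDiff w)).contDiff.comp_contDiffOn h1)))

theorem graphChart_symm_contDiff (w : S2) {g : S2 → ℝ} (hg : ContMDiff (𝓡 2) 𝓘(ℝ, ℝ) ∞ g) :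
    ContDiff ℝ ∞ (graphChart w hg).symm := by
  have h := (coe_chartInv_contDiff w).comp (contDiff_fst (E := EuclideanSpace ℝ (Fin 2)) (F := ℝ × ℝ))
  have h2 := (hg.comp (chartInv_contMDiff w)).contDiff.comp
    (contDiff_fst (E := EuclideanSpace ℝ (Fin 2)) (F := ℝ × ℝ))
  exact contDiff_appendLast ((contDiff_const.add (contDiff_fst.comp contDiff_snd)).smul h)
    ((contDiff_snd.comp contDiff_snd).add h2)

/-- In the standard chart at `w` and the straightening chart of `ℝ⁴`, the map reads `u ↦ (u, 0)`:
the two transverse coordinates, distance from the sphere and from the graph, vanish on the image. -/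
theorem graphEmb_isImmersion {η : S2 → ℝ} (hη : IsCutoff η) :
    Manifold.IsImmersion (𝓡 2) (𝓡 4) ∞ (graphEmb η) := by
  refine Manifold.IsImmersionOfComplement.isImmersion (F := ℝ × ℝ) fun w => ?_
  let A : (EuclideanSpace ℝ (Fin 2) × (ℝ × ℝ)) ≃L[ℝ] EuclideanSpace ℝ (Fin 4) :=
    ContinuousLinearEquiv.ofFinrankEq (by simp)
  have hH := bigH_contMDiff hη
  let Φ := (graphChart w hH).transHomeomorph A.toHomeomorph
  refine Manifold.IsImmersionAtOfComplement.mk_of_continuousAt (graphEmb_continuous hη).continuousAt A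
    (chartAt _ w) Φ (mem_chart_source _ w) ?_ (IsManifold.chart_mem_maximalAtlas w)
    (Φ.mem_maximalAtlas_of_contMDiffOn ?_ ?_) ?_
  · change dropLast (graphEmb η w) ∈ chartCone w
    rw [graphEmb_eq_appendLast, dropLast_appendLast, mem_chartCone_iff]
    exact ne_neg_of_mem_unit_sphere ℝ w
  · exact (A.contDiff.comp_contDiffOn (graphChart_contDiffOn w hH)).contMDiffOn
  · exact ((graphChart_symm_contDiff w hH).comp A.symm.contDiff).contDiffOn.contMDiffOn
  · intro u _
    change A (graphChart w hH (graphEmb η (chartInv w u))) = A (u, 0)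
    congr 1
    change (coneChart w (dropLast (graphEmb η (chartInv w u))), _, _) = _
    simp only [graphEmb_eq_appendLast, dropLast_appendLast, appendLast_last, coneChart_chartInv,
      norm_eq_of_mem_sphere, sub_self]
    rfl

/-! ### Homology -/

theorem homotopic_of_contractibleSpace {X Y : Type*} [TopologicalSpace X] [TopologicalSpace Y]
    [ContractibleSpace Y] (f g : C(X, Y)) : f.Homotopic g := by
  obtain ⟨y, h⟩ := id_nullhomotopic Y
  have h' : ∀ k : C(X, Y), k.Homotopic (ContinuousMap.const X y) := fun k =>
    ContinuousMap.Homotopic.comp h (ContinuousMap.Homotopic.refl k)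
  exact (h' f).trans (h' g).symm

theorem singularHomology_map_eq_of_contractibleSpace (R : Type) [CommRing R] (k : ℕ) {X Y : TopCat.{0}}
    [ContractibleSpace Y] (f g : X ⟶ Y) :
    ((singularHomologyFunctor (ModuleCat.{0} R) k).obj (ModuleCat.of R R)).map f =
      ((singularHomologyFunctor (ModuleCat.{0} R) k).obj (ModuleCat.of R R)).map g := by
  obtain ⟨H⟩ := homotopic_of_contractibleSpace f.hom g.hom
  exact TopCat.Homotopy.congr_homologyMap_singularChainComplexFunctor (f := f) (g := g) H
    (ModuleCat.of R R) k

/-- A constant map back is a homotopy inverse, since all maps into a contractible space are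
homotopic. -/
theorem isIso_singularHomology_map_of_contractibleSpace (R : Type) [CommRing R] (k : ℕ)
    {X Y : TopCat.{0}} [ContractibleSpace X] [ContractibleSpace Y] (f : X ⟶ Y) :
    IsIso (((singularHomologyFunctor (ModuleCat.{0} R) k).obj (ModuleCat.of R R)).map f) := by
  obtain ⟨x⟩ : Nonempty X := inferInstance
  let g : Y ⟶ X := TopCat.ofHom (ContinuousMap.const Y x)
  refine ⟨((singularHomologyFunctor (ModuleCat.{0} R) k).obj (ModuleCat.of R R)).map g, ?_, ?_⟩
  · rw [← CategoryTheory.Functor.map_comp, ← CategoryTheory.Functor.map_id]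
    exact singularHomology_map_eq_of_contractibleSpace R k _ _
  · rw [← CategoryTheory.Functor.map_comp, ← CategoryTheory.Functor.map_id]
    exact singularHomology_map_eq_of_contractibleSpace R k _ _

-- `H₀` is free on the path components, and a nonzero commutative ring has invariant basis number.
open Limits DirectSum in
theorem card_zerothHomotopy_eq_of_isIso (R : Type) [CommRing R] [Nontrivial R] {X Y : TopCat.{0}}
    [Finite (ZerothHomotopy X)] [Finite (ZerothHomotopy Y)] (f : X ⟶ Y)
    (hf : IsIso (((singularHomologyFunctor (ModuleCat.{0} R) 0).obj (ModuleCat.of R R)).map f)) :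
    Nat.card (ZerothHomotopy X) = Nat.card (ZerothHomotopy Y) := by
  classical
  have := Fintype.ofFinite (ZerothHomotopy X)
  have := Fintype.ofFinite (ZerothHomotopy Y)
  let i := (TopCat.singularHomology₀Iso X (ModuleCat.of R R)).symm ≪≫
    asIso (((singularHomologyFunctor (ModuleCat.{0} R) 0).obj (ModuleCat.of R R)).map f) ≪≫
    TopCat.singularHomology₀Iso Y (ModuleCat.of R R)
  let j := (ModuleCat.coprodIsoDirectSum fun _ : ZerothHomotopy X => ModuleCat.of R R).symm ≪≫ i ≪≫
    ModuleCat.coprodIsoDirectSum fun _ : ZerothHomotopy Y => ModuleCat.of R R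
  let e := (finsuppLEquivDirectSum R R (ZerothHomotopy X)).trans
    (j.toLinearEquiv.trans (finsuppLEquivDirectSum R R (ZerothHomotopy Y)).symm)
  simpa [Nat.card_eq_fintype_card] using e.finrank_eq

theorem isIso_sublevelHomologyMap_of_contractibleSpace (R : Type) [CommRing R] (k : ℕ) {X : Type}
    [TopologicalSpace X] (f : X → ℝ) {a b : ℝ} (hab : a ≤ b) [ContractibleSpace (sublevel f a)]
    [ContractibleSpace (sublevel f b)] : IsIso (sublevelHomologyMap R k f hab) :=
  have : ContractibleSpace (TopCat.of (sublevel f a)) := ‹ContractibleSpace (sublevel f a)›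
  have : ContractibleSpace (TopCat.of (sublevel f b)) := ‹ContractibleSpace (sublevel f b)›
  isIso_singularHomology_map_of_contractibleSpace R k (sublevelInclusion f hab)

theorem card_zerothHomotopy_sublevel_zero {η : S2 → ℝ} (hη : IsCutoff η) :
    Nat.card (ZerothHomotopy (sublevel (height η) 0)) = 3 := by
  rw [card_zerothHomotopy_of_label (componentLabel hη) (contractibleSpace_componentLabel hη)
    (componentLabel_eq_of_joined hη), Nat.card_eq_fintype_card]
  rfl

theorem not_isIso_sublevelHomologyMap_zero (R : Type) [CommRing R] [Nontrivial R] {η : S2 → ℝ}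
    (hη : IsCutoff η) {x : ℝ} (hx : x ∈ Ioo (-Real.exp (-16)) 0) :
    ¬ IsIso (sublevelHomologyMap R 0 (height η) hx.2.le) := by
  intro h
  have hc : ContractibleSpace (sublevel (height η) x) :=
    contractibleSpace_sublevel hη ⟨hx.1.le, hx.2.trans zero_lt_one⟩ hx.2.ne
  have h3 := card_zerothHomotopy_sublevel_zero hη
  have h1 : Nat.card (ZerothHomotopy (sublevel (height η) x)) = 1 :=
    Nat.card_eq_one_iff_unique.2
      ⟨(pathConnectedSpace_iff_zerothHomotopy.1 inferInstance).2,
        (pathConnectedSpace_iff_zerothHomotopy.1 inferInstance).1⟩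
  have : Finite (ZerothHomotopy (TopCat.of (sublevel (height η) x))) :=
    Nat.finite_of_card_ne_zero (h1 ▸ one_ne_zero)
  have : Finite (ZerothHomotopy (TopCat.of (sublevel (height η) 0))) :=
    Nat.finite_of_card_ne_zero (h3 ▸ three_ne_zero)
  have e := card_zerothHomotopy_eq_of_isIso R (sublevelInclusion (height η) hx.2.le) h
  have e' : Nat.card (ZerothHomotopy (sublevel (height η) x)) =
    Nat.card (ZerothHomotopy (sublevel (height η) 0)) := e
  omega

theorem not_isSymmetricHomologicalCriticalValue_height (R : Type) [CommRing R] {η : S2 → ℝ}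
    (hη : IsCutoff η) {a : ℝ} (ha : a ∈ Ioo (-Real.exp (-16)) 1) :
    ¬ IsSymmetricHomologicalCriticalValue R (height η) a := by
  rintro ⟨k, δ, hδ, h⟩
  obtain ⟨ε, hε0, hεδ, hlow, hupp, hne, hne'⟩ : ∃ ε > 0, ε < δ ∧ -Real.exp (-16) < a - ε ∧
      a + ε < 1 ∧ a - ε ≠ 0 ∧ a + ε ≠ 0 := by
    set m := min δ (min (a + Real.exp (-16)) (1 - a)) with hm
    have hm0 : 0 < m := lt_min hδ (lt_min (by linarith [ha.1]) (by linarith [ha.2]))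
    have h1 : m ≤ δ := min_le_left _ _
    have h2 : m ≤ a + Real.exp (-16) := (min_le_right _ _).trans (min_le_left _ _)
    have h3 : m ≤ 1 - a := (min_le_right _ _).trans (min_le_right _ _)
    -- Only `ε = |a|` makes one of `a ± ε` vanish, so one of `m / 2` and `m / 3` is admissible.
    by_cases ha' : |a| = m / 2
    · have : |a| ≠ m / 3 := by linarith
      refine ⟨m / 3, by linarith, by linarith, by linarith, by linarith, fun h => this ?_,
        fun h => this ?_⟩
      · rw [sub_eq_zero.1 h, abs_of_pos (by linarith)]
      · rw [eq_neg_of_add_eq_zero_left h, abs_neg, abs_of_pos (by linarith)]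
    · refine ⟨m / 2, by linarith, by linarith, by linarith, by linarith, fun h => ha' ?_,
        fun h => ha' ?_⟩
      · rw [sub_eq_zero.1 h, abs_of_pos (by linarith)]
      · rw [eq_neg_of_add_eq_zero_left h, abs_neg, abs_of_pos (by linarith)]
  have := contractibleSpace_sublevel hη (a := a - ε) ⟨hlow.le, by linarith⟩ hne
  have := contractibleSpace_sublevel hη (a := a + ε) ⟨by linarith, hupp⟩ hne'
  exact h ε hε0 hεδ (isIso_sublevelHomologyMap_of_contractibleSpace R k (height η) _)

theorem mainTheorem2 :
    (∃ η : S2 → ℝ, IsCutoff η) ∧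
    ∀ η : S2 → ℝ, IsCutoff η →
      -- `H` is smooth, and `i` embeds `S²` smoothly as a compact surface in `ℝ⁴`
      ContMDiff (𝓡 2) 𝓘(ℝ, ℝ) ∞ (bigH η) ∧
      Manifold.IsSmoothEmbedding (𝓡 2) (𝓡 4) ∞ (graphEmb η) ∧
      IsCompact (Set.range (graphEmb η)) ∧
      -- sublevel sets just below and just above level `0` are contractible
      (∀ a ∈ Set.Ico (-Real.exp (-16)) 0, ContractibleSpace (sublevel (height η) a)) ∧
      (∀ a ∈ Set.Ioo (0 : ℝ) 1, ContractibleSpace (sublevel (height η) a)) ∧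
      -- the sublevel set at `0` is connected, with three contractible path components
      ConnectedSpace (sublevel (height η) 0) ∧
      Nat.card (ZerothHomotopy (sublevel (height η) 0)) = 3 ∧
      (∀ q : sublevel (height η) 0, ContractibleSpace (pathComponent q)) ∧
      -- no symmetric homological critical values near `0`, and failure of the critical value lemma
      ∀ (R : Type) [CommRing R] [Nontrivial R],
        (∀ a ∈ Set.Ioo (-Real.exp (-16)) 1,
          ¬ IsSymmetricHomologicalCriticalValue R (height η) a) ∧
        (∀ (x : ℝ) (hx : x ∈ Set.Ioo (-Real.exp (-16)) 0),
          ¬ CategoryTheory.IsIso (sublevelHomologyMap R 0 (height η) hx.2.le)) ∧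
        ¬ SatisfiesCriticalValueLemma R (height η) := by

  refine ⟨exists_isCutoff, fun η hη => ⟨bigH_contMDiff hη,
    ⟨graphEmb_isImmersion hη, graphEmb_isEmbedding hη⟩, isCompact_range (graphEmb_continuous hη),
    fun a ha => contractibleSpace_sublevel hη ⟨ha.1, ha.2.trans zero_lt_one⟩ ha.2.ne,
    fun a ha => contractibleSpace_sublevel hη
      ⟨(neg_nonpos.2 (Real.exp_pos _).le).trans ha.1.le, ha.2⟩ ha.1.ne',
    connectedSpace_sublevel_zero hη, card_zerothHomotopy_sublevel_zero hη,
    contractibleSpace_pathComponent_of_label (componentLabel hη)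
      (contractibleSpace_componentLabel hη) (componentLabel_eq_of_joined hη),
    fun R _ _ => ⟨fun a ha => not_isSymmetricHomologicalCriticalValue_height R hη ha,
      fun x hx => not_isIso_sublevelHomologyMap_zero R hη hx, fun h => ?_⟩⟩⟩
  have hx : -Real.exp (-16) / 2 ∈ Ioo (-Real.exp (-16)) 0 := by
    have := Real.exp_pos (-16)
    constructor <;> linarith
  exact not_isIso_sublevelHomologyMap_zero R hη hx (h _ _ hx.2.le (fun c hc =>
    not_isSymmetricHomologicalCriticalValue_height R hη
      ⟨hx.1.trans_le hc.1, hc.2.trans_lt zero_lt_one⟩) 0)
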